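/- **Theorem.** Language emptiness for DFA[Reach-1-DVASS] is undecidable. That is, there is no algorithm (computable function) which, given the finite description of a DFA[Reach-1-DVASS] $A$, decides whether $L(A)=\emptyset$. Here the notions are as follows. A *one-dimensional deterministic VASS* (1-DVASS) over a finite alphabet $\Sigma$ is a tuple $G=(\Sigma,Q,T,q_0,F)$ with a finite set $Q$ of states, an initial state $q_0\in Q$, a set $F\subseteq Q$ of accepting states and a finite set $T\subseteq Q\times\Sigma\times\mathbb{Z}\times Q$ of transitions that contains, for each $q\in Q$ and $\sigma\in\Sigma$, at most one transition of the form $(q,\sigma,u,q')$. Its configurations are the pairs $(q,x)\in Q\times\mathbb{N}$; a transition $(q,\sigma,u,q')$ leads from $(q,x)$ to $(q',x+u)$ and can be taken only if $x+u\ge 0$. Under *reachability acceptance*, $L(G)$ is the set of words $w\in\Sigma^*$ that label a run from $(q_0,0)$ to $(q,0)$ for some $q\in F$. A *DFA[Reach-1-DVASS]* $A$ over a finite alphabet $\Sigma$ consists of a deterministic finite automaton $U=(\Sigma,Q,T,q_0,F)$, with $T\subseteq Q\times\Sigma\times Q$ containing at most one transition $(q,\sigma,q')$ for each $q\in Q$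 and $\sigma\in\Sigma$, and, for each transition $t\in T$, a 1-DVASS $G_t$ over $\Sigma$. A word $a_1\cdots a_n\in\Sigma^*$ belongs to $L(A)$ if there are states $q_1,\dots,q_n\in Q$, starting from the initial state $q_0$, such that $q_n\in F$ and, for every $1\le i\le n$, $t_i=(q_{i-1},a_i,q_i)\in T$ and $a_1\cdots a_{i-1}\in L(G_{t_i})$. -/

import Mathlib

/-!
History-constrained systems whose underlying automaton is a DFA and whose guards are
one-dimensional deterministic vector addition systems with states under reachability acceptance.

Machines are given as finite data, so that they can be the input of an algorithm: an alphabet of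
size `k` is `{0, …, k - 1}`, a state set of size `n` is `{0, …, n - 1}`, and finite sets of
transitions and of accepting states are given by lists of their elements.
-/

/-- A `d`-dimensional vector addition system with states over the alphabet
`{0, …, numLetters - 1}` with states `{0, …, numStates - 1}`. A transition is a tuple
`(q, a, u, q')` of source state, letter, counter update and target state. -/
structure VASS (d : ℕ) where
  numLetters : ℕ
  numStates : ℕ
  trans : List (ℕ × ℕ × (Fin d → ℤ) × ℕ)
  init : ℕ
  accept : List ℕ

namespace VASS

variable {d : ℕ}

/-- The components are drawn from the declared alphabet and state set. -/
def WellFormed (V : VASS d) : Prop :=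
  V.init < V.numStates ∧
  (∀ q ∈ V.accept, q < V.numStates) ∧
  ∀ q a u q', (q, a, u, q') ∈ V.trans →
    q < V.numStates ∧ a < V.numLetters ∧ q' < V.numStates

/-- For each state and letter there is at most one outgoing transition. -/
def Deterministic (V : VASS d) : Prop :=
  ∀ q a u₁ q₁ u₂ q₂, (q, a, u₁, q₁) ∈ V.trans → (q, a, u₂, q₂) ∈ V.trans →
    u₁ = u₂ ∧ q₁ = q₂

/-- A configuration: a state together with non-negative counter values. -/
abbrev Config (d : ℕ) : Type := ℕ × (Fin d → ℕ)

/-- `V.Step c a c'`: some transition labelled `a` leads from `c` to `c'`. As the counter values of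
`c'` are natural numbers, the transition can only be taken if no counter drops below zero. -/
def Step (V : VASS d) (c : Config d) (a : ℕ) (c' : Config d) : Prop :=
  ∃ u : Fin d → ℤ, (c.1, a, u, c'.1) ∈ V.trans ∧ ∀ i, (c'.2 i : ℤ) = (c.2 i : ℤ) + u i

/-- `V.Run w c`: there is a run of `V` on the word `w` from the initial state with all counters
zero to the configuration `c`. -/
inductive Run (V : VASS d) : List ℕ → Config d → Prop
  | nil : Run V [] (V.init, fun _ => 0)
  | snoc {w : List ℕ} {c c' : Config d} {a : ℕ} :
      Run V w c → V.Step c a c' → Run V (w ++ [a]) c'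

/-- The language of `V` under reachability acceptance: the words that lead to an accepting state
with all counters zero. -/
def reachLanguage (V : VASS d) : Set (List ℕ) :=
  {w | ∃ q ∈ V.accept, V.Run w (q, fun _ => 0)}

/-- A VASS as a tuple of finite data. -/
def equivTuple (d : ℕ) :
    VASS d ≃ ℕ × ℕ × List (ℕ × ℕ × (Fin d → ℤ) × ℕ) × ℕ × List ℕ where
  toFun V := (V.numLetters, V.numStates, V.trans, V.init, V.accept)
  invFun p := ⟨p.1, p.2.1, p.2.2.1, p.2.2.2.1, p.2.2.2.2⟩
  left_inv _ := rfl
  right_inv _ := rfl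

instance (d : ℕ) : Primcodable (VASS d) := Primcodable.ofEquiv _ (equivTuple d)

end VASS

/-- A history-constrained system over the letters `α`: a labelled transition system with an initial
state and accepting states, in which each transition `t` carries a guard language `guard t`. (The
values of `guard` on triples that are not transitions play no role.) -/
structure HCS (α Q : Type*) where
  trans : Set (Q × α × Q)
  init : Q
  accept : Set Q
  guard : Q × α × Q → Set (List α)

namespace HCS

variable {α Q : Type*}

/-- `A.Run w q`: some run of `A` from the initial state reads `w` and ends in `q`. A transition can
be taken only if the word read before it belongs to the guard of the transition. -/
inductive Run (A : HCS α Q) : List α → Q → Prop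
  | nil : Run A [] A.init
  | snoc {w : List α} {q q' : Q} {a : α} :
      Run A w q → (q, a, q') ∈ A.trans → w ∈ A.guard (q, a, q') → Run A (w ++ [a]) q'

/-- The words on which there is an accepting run. -/
def language (A : HCS α Q) : Set (List α) :=
  {w | ∃ q ∈ A.accept, A.Run w q}

end HCS

/-- Finite data that specify a history-constrained system over the alphabet
`{0, …, numLetters - 1}` with states `{0, …, numStates - 1}`, whose guards are given by
one-dimensional VASS. An element `((q, a, q'), G)` of the list `trans` is a transition
`(q, a, q')` together with the VASS `G` that specifies its guard. -/
structure GuardedFA where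
  numLetters : ℕ
  numStates : ℕ
  trans : List ((ℕ × ℕ × ℕ) × VASS 1)
  init : ℕ
  accept : List ℕ

namespace GuardedFA

/-- A system as a tuple of finite data. -/
def equivTuple : GuardedFA ≃ ℕ × ℕ × List ((ℕ × ℕ × ℕ) × VASS 1) × ℕ × List ℕ where
  toFun A := (A.numLetters, A.numStates, A.trans, A.init, A.accept)
  invFun p := ⟨p.1, p.2.1, p.2.2.1, p.2.2.2.1, p.2.2.2.2⟩
  left_inv _ := rfl
  right_inv _ := rfl

instance : Primcodable GuardedFA := Primcodable.ofEquiv _ equivTuple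

/-- `A` specifies a deterministic history-constrained system with one-dimensional deterministic
VASS as guards, all over one alphabet. The last clause says that the underlying automaton is a DFA
(at most one transition for each state and letter, and no transition without a letter), and that
each transition has exactly one guard. -/
def IsDFAReachOneDVASS (A : GuardedFA) : Prop :=
  A.init < A.numStates ∧
  (∀ q ∈ A.accept, q < A.numStates) ∧
  (∀ q a q' G, ((q, a, q'), G) ∈ A.trans →
    q < A.numStates ∧ a < A.numLetters ∧ q' < A.numStates ∧
    G.numLetters = A.numLetters ∧ G.WellFormed ∧ G.Deterministic) ∧
  ∀ q a q₁ G₁ q₂ G₂, ((q, a, q₁), G₁) ∈ A.trans → ((q, a, q₂), G₂) ∈ A.trans →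
    q₁ = q₂ ∧ G₁ = G₂

/-- The history-constrained system specified by `A`: guards are the languages of the given VASS
under reachability acceptance. -/
def toHCS (A : GuardedFA) : HCS ℕ ℕ where
  trans := {t | ∃ G, (t, G) ∈ A.trans}
  init := A.init
  accept := {q | q ∈ A.accept}
  guard t := {w | ∃ G, (t, G) ∈ A.trans ∧ w ∈ G.reachLanguage}

/-- The language of the history-constrained system specified by `A`. -/
def language (A : GuardedFA) : Set (List ℕ) := A.toHCS.language

end GuardedFA

/-!
The halting problem is reduced to language non-emptiness.

A program is a regular set of words over the letters "increment counter `i`", "decrement counter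
`i`" and "test counter `i` for zero". It relates two states (assignments of values to the counters)
if one of its words leads from the first to the second. Union, product and star of languages become
choice, composition and iteration of programs, so that regular languages are a structured
programming language for counter machines; they are closed under product and star because these
operations keep the set of left quotients finite. By induction on the definition of primitive
recursive functions on vectors, every such function is computed by a program with a unique outcome
(`computes_of_primrec'`). Halting is an existentially quantified primitive recursive condition, and
a star of increments guesses the witness. Hence there is a single program that leads from the zero
state to the zero state exactly if the code that it is given as input halts
(`exists_program_of_primrec`). The input `n` enters only through one extra letter, `0`, that adds
`n` to counter `0`.

A word of a program can be executed only if no counter becomes negative and every zero test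
succeeds. Single guards can see this: the deterministic VASS with one state that follows counter
`i` accepts a word by reachability exactly if counter `i` never is negative along the word and is
zero at its end. So a DFA for the program is taken, and every letter "test counter `i` for zero" is
guarded by the VASS of counter `i`. Decrements are unguarded, but a negative counter is detected at
the next test of that counter. Therefore the program is followed by a test of each counter, which
is harmless because only runs that end in the zero state matter (`exists_system_of_isProgram`).
The input occurs in the resulting system only as a number in the guards, and the system is a
primitive recursive function of it (`primrec_system`).
-/

open scoped Computability

/-! ### Closure properties of regular languages -/

namespace Language

variable {α : Type*}

theorem isRegular_zero : (0 : Language α).IsRegular :=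
  ⟨Unit, inferInstance, ⟨fun _ _ => (), (), ∅⟩, by ext w; simp [DFA.mem_accepts]⟩

theorem isRegular_singleton_letter (a : α) : ({[a]} : Language α).IsRegular := by
  apply IsRegular.of_finite_range_leftQuotient
  refine Set.Finite.subset (s := {{[a]}, 1, 0}) (by simp) ?_
  rintro _ ⟨x, rfl⟩
  rcases x with _ | ⟨b, x⟩
  · left; rfl
  · right
    by_cases h : b = a ∧ x = []
    · left
      obtain ⟨rfl, rfl⟩ := h
      ext y
      rw [mem_leftQuotient, mem_one]
      change [b] ++ y = [b] ↔ _
      simp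
    · right
      ext y
      rw [mem_leftQuotient]
      change (b :: x) ++ y = [a] ↔ y ∈ (0 : Language α)
      simp only [notMem_zero, iff_false]
      intro e
      simp at e
      tauto

/-- A left quotient of `L₁ * L₂` is determined by a left quotient of `L₁` and a set of left
quotients of `L₂`. -/
theorem IsRegular.mul {L₁ L₂ : Language α} (h₁ : L₁.IsRegular) (h₂ : L₂.IsRegular) :
    (L₁ * L₂).IsRegular := by
  apply IsRegular.of_finite_range_leftQuotient
  refine Set.Finite.subset ((h₁.finite_range_leftQuotient.prod
    h₂.finite_range_leftQuotient.powerset).image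
      fun p : Language α × Set (Language α) => p.1 * L₂ + sSup p.2) ?_
  rintro _ ⟨x, rfl⟩
  refine ⟨(L₁.leftQuotient x, {M | ∃ u v, x = u ++ v ∧ u ∈ L₁ ∧ M = L₂.leftQuotient v}),
    ⟨⟨x, rfl⟩, ?_⟩, ?_⟩
  · rintro _ ⟨u, v, -, -, rfl⟩
    exact ⟨v, rfl⟩
  · ext y
    rw [mem_leftQuotient, mem_add, mem_mul, mem_mul]
    change _ ∨ (∃ M ∈ _, y ∈ M) ↔ _
    constructor
    · rintro (⟨a, ha, b, hb, rfl⟩ | ⟨_, ⟨u, v, rfl, hu, rfl⟩, hy⟩)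
      · exact ⟨x ++ a, ha, b, hb, by simp⟩
      · exact ⟨u, hu, v ++ y, hy, by simp⟩
    · rintro ⟨a, ha, b, hb, e⟩
      rcases List.append_eq_append_iff.1 e with ⟨c, rfl, rfl⟩ | ⟨c, rfl, rfl⟩
      · exact Or.inr ⟨_, ⟨a, c, rfl, ha, rfl⟩, hb⟩
      · exact Or.inl ⟨c, ha, b, hb, rfl⟩

theorem append_mem_kstar_iff {L : Language α} {x y : List α} :
    x ++ y ∈ L∗ ↔ (x ∈ L∗ ∧ y = []) ∨
      ∃ u v, x = u ++ v ∧ u ∈ L∗ ∧ y ∈ L.leftQuotient v * L∗ := by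
  have app : ∀ {a b : List α}, a ∈ L∗ → b ∈ L∗ → a ++ b ∈ L∗ := fun ha hb => by
    rw [← kstar_mul_kstar]
    exact append_mem_mul ha hb
  have lif : ∀ {a : List α}, a ∈ L → a ∈ L∗ := fun ha => le_kstar (a := L) ha
  constructor
  · intro h
    obtain ⟨S, e, hS⟩ := mem_kstar.1 h
    clear h
    induction S generalizing x with
    | nil =>
      simp only [List.flatten_nil, List.append_eq_nil_iff] at e
      obtain ⟨rfl, rfl⟩ := e
      exact Or.inl ⟨nil_mem_kstar L, rfl⟩
    | cons a S ih =>
      have ha : a ∈ L := hS a (by simp)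
      have hS' : ∀ z ∈ S, z ∈ L := fun z hz => hS z (by simp [hz])
      rw [List.flatten_cons] at e
      rcases List.append_eq_append_iff.1 e with ⟨c, rfl, rfl⟩ | ⟨c, rfl, e'⟩
      · exact Or.inr ⟨[], x, rfl, nil_mem_kstar L,
          append_mem_mul (by simpa [mem_leftQuotient] using ha) (mem_kstar.2 ⟨S, rfl, hS'⟩)⟩
      · rcases ih e'.symm hS' with ⟨hc, rfl⟩ | ⟨u, v, rfl, hu, hy⟩
        · exact Or.inl ⟨app (lif ha) hc, rfl⟩
        · exact Or.inr ⟨a ++ u, v, by simp, app (lif ha) hu, hy⟩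
  · rintro (⟨hx, rfl⟩ | ⟨u, v, rfl, hu, hy⟩)
    · simpa using hx
    · obtain ⟨a, ha, b, hb, rfl⟩ := mem_mul.1 hy
      have := app hu (app (lif ha) hb)
      simpa using this

/-- A left quotient of `L∗` is determined by a set of left quotients of `L`, up to the empty
word. -/
theorem IsRegular.kstar {L : Language α} (h : L.IsRegular) : (L∗).IsRegular := by
  apply IsRegular.of_finite_range_leftQuotient
  refine Set.Finite.subset ((h.finite_range_leftQuotient.powerset.prod
    (Set.toFinite ({0, 1} : Set (Language α)))).image
      fun p : Set (Language α) × Language α => sSup p.1 * L∗ + p.2) ?_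
  rintro _ ⟨x, rfl⟩
  classical
  refine ⟨({M | ∃ u v, x = u ++ v ∧ u ∈ L∗ ∧ M = L.leftQuotient v}, if x ∈ L∗ then 1 else 0),
    ⟨?_, by dsimp only; split_ifs <;> simp⟩, ?_⟩
  · rintro _ ⟨u, v, -, -, rfl⟩
    exact ⟨v, rfl⟩
  · ext y
    rw [mem_leftQuotient, append_mem_kstar_iff, mem_add, or_comm]
    refine or_congr ?_ ?_
    · by_cases hx : x ∈ L∗ <;> simp [hx, mem_one]
    · simp only [mem_mul]
      constructor
      · rintro ⟨a, ⟨_, ⟨u, v, hx, hu, rfl⟩, ha⟩, b, hb, rfl⟩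
        exact ⟨u, v, hx, hu, a, ha, b, hb, rfl⟩
      · rintro ⟨u, v, hx, hu, a, ha, b, hb, rfl⟩
        exact ⟨a, ⟨_, ⟨u, v, hx, hu, rfl⟩, ha⟩, b, hb, rfl⟩

end Language

/-! ### Counter programs -/

namespace CounterProgram

/-- The contents of the counters. -/
abbrev State : Type := ℕ → ℕ

/-- The letter that increments counter `i`. -/
def inc (i : ℕ) : ℕ := 3 * i + 1

/-- The letter that decrements counter `i`. -/
def dec (i : ℕ) : ℕ := 3 * i + 2

/-- The letter that tests whether counter `i` is zero. -/
def zero (i : ℕ) : ℕ := 3 * i + 3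

/-- The change of counter `i` by the letter `a`, for the input `n`. The letter `0`, which is none of
`inc i`, `dec i` and `zero i`, adds the input to counter `0`. -/
def update (n i a : ℕ) : ℤ :=
  if a = 0 then (if i = 0 then n else 0)
  else if a = inc i then 1 else if a = dec i then -1 else 0

/-- The letter `a` leads from `s` to `t`. As counters are natural numbers, a decrement of a counter
that is zero is impossible. -/
def Step (n a : ℕ) (s t : State) : Prop :=
  (∀ i, (t i : ℤ) = s i + update n i a) ∧ ∀ i, a = zero i → s i = 0

/-- The word `w` leads from `s` to `t`. -/
def Exec (n : ℕ) : List ℕ → State → State → Prop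
  | [], s, t => t = s
  | a :: w, s, t => ∃ r, Step n a s r ∧ Exec n w r t

theorem exec_append {n : ℕ} {u v : List ℕ} {s t : State} :
    Exec n (u ++ v) s t ↔ ∃ r, Exec n u s r ∧ Exec n v r t := by
  induction u generalizing s with
  | nil => simp [Exec]
  | cons a u ih =>
    simp only [List.cons_append, Exec, ih]
    constructor
    · rintro ⟨r, h, q, h', h''⟩
      exact ⟨q, ⟨r, h, h'⟩, h''⟩
    · rintro ⟨q, ⟨r, h, h'⟩, h''⟩
      exact ⟨r, h, q, h', h''⟩

/-- Some word of the program `P` leads from `s` to `t`, for the input `n`. -/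
def Sem (n : ℕ) (P : Language ℕ) (s t : State) : Prop :=
  ∃ w ∈ P, Exec n w s t

/-- A program is a regular set of words over a finite set of letters. -/
def IsProgram (P : Language ℕ) : Prop :=
  P.IsRegular ∧ ∃ K, ∀ w ∈ P, ∀ a ∈ w, a < K

variable {n : ℕ} {P Q : Language ℕ} {s t : State}

theorem isProgram_letter (a : ℕ) : IsProgram {[a]} :=
  ⟨Language.isRegular_singleton_letter a, a + 1, by
    rintro w rfl b hb
    simp at hb
    omega⟩

theorem IsProgram.mul (hP : IsProgram P) (hQ : IsProgram Q) : IsProgram (P * Q) := by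
  obtain ⟨hP, K, hK⟩ := hP
  obtain ⟨hQ, M, hM⟩ := hQ
  refine ⟨hP.mul hQ, max K M, ?_⟩
  rintro _ ⟨u, hu, v, hv, rfl⟩ a ha
  rcases List.mem_append.1 ha with ha | ha
  · exact lt_max_of_lt_left (hK u hu a ha)
  · exact lt_max_of_lt_right (hM v hv a ha)

theorem IsProgram.kstar (hP : IsProgram P) : IsProgram P∗ := by
  obtain ⟨hP, K, hK⟩ := hP
  refine ⟨hP.kstar, K, ?_⟩
  rintro _ ⟨S, rfl, hS⟩ a ha
  obtain ⟨v, hv, ha⟩ := List.mem_flatten.1 ha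
  exact hK v (hS v hv) a ha

theorem isProgram_one : IsProgram 1 := by
  refine ⟨?_, 0, ?_⟩
  · rw [← kstar_zero]
    exact Language.isRegular_zero.kstar
  · intro w hw
    rw [Language.mem_one] at hw
    simp [hw]

theorem sem_one : Sem n 1 s t ↔ t = s := by
  constructor
  · rintro ⟨w, hw, h⟩
    rw [Language.mem_one] at hw
    subst hw
    exact h
  · exact fun h => ⟨[], Language.nil_mem_one, h⟩

theorem sem_mul : Sem n (P * Q) s t ↔ ∃ r, Sem n P s r ∧ Sem n Q r t := by
  constructor
  · rintro ⟨_, ⟨u, hu, v, hv, rfl⟩, h⟩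
    obtain ⟨r, h, h'⟩ := exec_append.1 h
    exact ⟨r, ⟨u, hu, h⟩, v, hv, h'⟩
  · rintro ⟨r, ⟨u, hu, h⟩, v, hv, h'⟩
    exact ⟨u ++ v, Language.append_mem_mul hu hv, exec_append.2 ⟨r, h, h'⟩⟩

theorem sem_add : Sem n (P + Q) s t ↔ Sem n P s t ∨ Sem n Q s t := by
  simp only [Sem, Language.mem_add, or_and_right, exists_or]

theorem sem_letter {a : ℕ} : Sem n {[a]} s t ↔ Step n a s t := by
  constructor
  · rintro ⟨w, rfl, r, h, e⟩
    rwa [show t = r from e]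
  · exact fun h => ⟨[a], rfl, t, h, rfl⟩

theorem update_inc (n j i : ℕ) : update n j (inc i) = if j = i then 1 else 0 := by
  have : inc i ≠ 0 := by simp [inc]
  have : inc i = inc j ↔ j = i := by simp only [inc]; omega
  have : inc i ≠ dec j := by simp only [inc, dec]; omega
  simp [update, *]

theorem update_dec (n j i : ℕ) : update n j (dec i) = if j = i then -1 else 0 := by
  have : dec i ≠ 0 := by simp [dec]
  have : dec i = dec j ↔ j = i := by simp only [dec]; omega
  have : dec i ≠ inc j := by simp only [inc, dec]; omega
  simp [update, *]

theorem update_zero (n j i : ℕ) : update n j (zero i) = 0 := by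
  have : zero i ≠ 0 := by simp [zero]
  have : zero i ≠ inc j := by simp only [inc, zero]; omega
  have : zero i ≠ dec j := by simp only [dec, zero]; omega
  simp [update, *]

theorem update_input (n j : ℕ) : update n j 0 = if j = 0 then (n : ℤ) else 0 := by
  simp [update]

theorem sem_inc {i : ℕ} :
    Sem n {[inc i]} s t ↔ t = Function.update s i (s i + 1) := by
  simp only [sem_letter, Step, update_inc, funext_iff, Function.update_apply]
  constructor
  · intro h j
    have := h.1 j
    split_ifs at * <;> subst_vars <;> omega
  · intro h
    refine ⟨fun j => ?_, fun j h => by simp only [inc, zero] at h; omega⟩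
    have := h j
    split_ifs at * <;> subst_vars <;> omega

theorem sem_dec {i : ℕ} :
    Sem n {[dec i]} s t ↔ s i ≠ 0 ∧ t = Function.update s i (s i - 1) := by
  simp only [sem_letter, Step, update_dec, funext_iff, Function.update_apply]
  constructor
  · intro h
    have hi := h.1 i
    rw [if_pos rfl] at hi
    refine ⟨by omega, fun j => ?_⟩
    have := h.1 j
    split_ifs at * <;> subst_vars <;> omega
  · rintro ⟨h0, h⟩
    refine ⟨fun j => ?_, fun j h => by simp only [dec, zero] at h; omega⟩
    have := h j
    split_ifs at * <;> subst_vars <;> omega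

theorem sem_zero {i : ℕ} : Sem n {[zero i]} s t ↔ s i = 0 ∧ t = s := by
  have hz : ∀ j, zero i = zero j ↔ j = i := fun j => by simp only [zero]; omega
  simp only [sem_letter, Step, update_zero, add_zero, Nat.cast_inj, hz, forall_eq, funext_iff]
  exact and_comm

theorem sem_input : Sem n {[0]} s t ↔ t = Function.update s 0 (s 0 + n) := by
  simp only [sem_letter, Step, update_input, funext_iff, Function.update_apply]
  constructor
  · intro h j
    have := h.1 j
    split_ifs at * <;> subst_vars <;> omega
  · intro h
    refine ⟨fun j => ?_, fun j h => by simp only [zero] at h; omega⟩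
    have := h j
    split_ifs at * <;> subst_vars <;> omega

theorem sem_kstar_inc {i : ℕ} :
    Sem n ({[inc i]}∗) s t ↔ ∃ k, t = Function.update s i (s i + k) := by
  have key : ∀ k (s : State), Sem n (({[inc i]} : Language ℕ) ^ k) s t ↔
      t = Function.update s i (s i + k) := by
    intro k
    induction k with
    | zero => intro s; simp [sem_one]
    | succ k ih =>
      intro s
      rw [pow_succ', sem_mul]
      simp only [sem_inc, exists_eq_left, ih, Function.update_self, Function.update_idem]
      rw [add_assoc, add_comm 1 k]
  simp only [← key]
  rw [Language.kstar_eq_iSup_pow]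
  simp only [Sem, Language.mem_iSup]
  constructor
  · rintro ⟨w, ⟨k, hw⟩, h⟩
    exact ⟨k, w, hw, h⟩
  · rintro ⟨k, w, hw, h⟩
    exact ⟨w, ⟨k, hw⟩, h⟩

/-! ### Programs with a unique outcome -/

/-- From `s`, the program `P` can reach the state `t` and no other. -/
def Det (n : ℕ) (P : Language ℕ) (s t : State) : Prop :=
  ∀ r, Sem n P s r ↔ r = t

theorem det_one : Det n 1 s s := fun _ => sem_one

theorem det_inc (i : ℕ) : Det n {[inc i]} s (Function.update s i (s i + 1)) := fun _ => sem_inc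

theorem Det.mul {r : State} (hP : Det n P s r) (hQ : Det n Q r t) : Det n (P * Q) s t := by
  intro q
  rw [sem_mul]
  simp only [hP _, exists_eq_left]
  exact hQ q

theorem Det.congr {t' : State} (h : Det n P s t) (e : t = t') : Det n P s t' := e ▸ h

/-- The program that repeats `B`, each time after a decrement of counter `c`, until this counter
is zero. -/
def loop (c : ℕ) (B : Language ℕ) : Language ℕ :=
  ({[dec c]} * B)∗ * {[zero c]}

theorem isProgram_loop (c : ℕ) {B : Language ℕ} (hB : IsProgram B) : IsProgram (loop c B) :=
  ((isProgram_letter _).mul hB).kstar.mul (isProgram_letter _)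

theorem loop_eq (c : ℕ) (B : Language ℕ) :
    loop c B = {[zero c]} + {[dec c]} * (B * loop c B) := by
  conv_lhs => rw [loop, ← Language.one_add_self_mul_kstar_eq_kstar, add_mul, one_mul]
  simp only [loop, mul_assoc]

theorem det_loop {c : ℕ} {B : Language ℕ} (k : ℕ) (σ : ℕ → State)
    (h : ∀ i < k, σ i c ≠ 0 ∧ Det n B (Function.update (σ i) c (σ i c - 1)) (σ (i + 1)))
    (hk : σ k c = 0) : Det n (loop c B) (σ 0) (σ k) := by
  induction k generalizing σ with
  | zero =>
    intro r
    rw [loop_eq, sem_add, sem_zero, sem_mul]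
    simp [sem_dec, hk]
  | succ k ih =>
    intro r
    obtain ⟨h0, hB⟩ := h 0 (by omega)
    have ih := ih (fun i => σ (i + 1)) (fun i hi => h (i + 1) (by omega)) hk
    rw [loop_eq, sem_add, sem_zero, sem_mul]
    simp only [sem_dec, h0, false_and, false_or, ne_eq, not_false_eq_true, true_and,
      exists_eq_left]
    exact hB.mul ih r

/-- The program that sets counter `i` to zero. -/
def clear (i : ℕ) : Language ℕ := loop i 1

theorem isProgram_clear (i : ℕ) : IsProgram (clear i) := isProgram_loop i isProgram_one

theorem det_clear (i : ℕ) : Det n (clear i) s (Function.update s i 0) := by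
  have := det_loop (n := n) (B := 1) (c := i) (s i) (fun j => Function.update s i (s i - j))
    (fun j hj => ⟨by simp; omega, by
      refine det_one.congr ?_
      simp only [Function.update_self, Function.update_idem]
      congr 1⟩) (by simp)
  simpa [clear] using this

/-- The program that adds counter `i` to counter `o`, using counter `t` as an intermediate
store. -/
def copy (i o t : ℕ) : Language ℕ :=
  loop i ({[inc t]} * {[inc o]}) * loop t {[inc i]}

theorem isProgram_copy (i o t : ℕ) : IsProgram (copy i o t) :=
  (isProgram_loop _ ((isProgram_letter _).mul (isProgram_letter _))).mul
    (isProgram_loop _ (isProgram_letter _))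

theorem det_copy {i o t : ℕ} (hio : i ≠ o) (hit : i ≠ t) (hot : o ≠ t) (ht : s t = 0) :
    Det n (copy i o t) s (Function.update s o (s o + s i)) := by
  have h₁ := det_loop (n := n) (B := {[inc t]} * {[inc o]}) (c := i) (s i)
    (fun j => Function.update (Function.update (Function.update s i (s i - j)) t j) o (s o + j))
    (fun j hj => ⟨by simp [hio, hit]; omega, by
      refine ((det_inc _).mul (det_inc _)).congr ?_
      funext r
      simp only [Function.update_apply]
      split_ifs <;> omega⟩) (by simp [hio, hit])
  have h₂ := det_loop (n := n) (B := {[inc i]}) (c := t) (s i)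
    (fun j => Function.update (Function.update (Function.update s i j) t (s i - j)) o (s o + s i))
    (fun j hj => ⟨by simp [hot.symm]; omega, by
      refine (det_inc _).congr ?_
      funext r
      simp only [Function.update_apply]
      split_ifs <;> omega⟩) (by simp [hot.symm])
  have e₁ : Function.update (Function.update (Function.update s i (s i - 0)) t 0) o (s o + 0) =
      s := by
    funext r
    simp only [Function.update_apply]
    split_ifs with h h' h'' <;> subst_vars <;> omega
  have e₂ : Function.update (Function.update (Function.update s i (s i)) t (s i - s i)) o
      (s o + s i) = Function.update s o (s o + s i) := by
    funext r
    simp only [Function.update_apply]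
    split_ifs with h h' h'' <;> subst_vars <;> omega
  have e₃ : Function.update (Function.update (Function.update s i (s i - s i)) t (s i)) o
      (s o + s i) = Function.update (Function.update (Function.update s i 0) t (s i - 0)) o
      (s o + s i) := by
    simp
  simp only [e₁, e₃] at h₁
  simp only [e₂] at h₂
  exact h₁.mul h₂

theorem exists_clear_range (m k : ℕ) : ∃ P, IsProgram P ∧
    ∀ n s, Det n P s fun r => if m ≤ r ∧ r < m + k then 0 else s r := by
  induction k with
  | zero =>
    refine ⟨1, isProgram_one, fun n s => det_one.congr ?_⟩
    funext r
    rw [if_neg (by omega)]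
  | succ k ih =>
    obtain ⟨P, hP, h⟩ := ih
    refine ⟨P * clear (m + k), hP.mul (isProgram_clear _), fun n s =>
      ((h n s).mul (det_clear _)).congr ?_⟩
    funext r
    simp only [Function.update_apply]
    split_ifs <;> omega

end CounterProgram

/-! ### Programs for primitive recursive functions -/

namespace CounterProgram

/-- The function `f` can be computed by programs: for all input counters `ins` and every output
counter `o`, some program adds the value of `f` at the contents of `ins` to `o`. It uses the
counters from `m` on as scratch space, which has to be zero initially and is zero again
afterwards. The program depends neither on the contents of the counters nor on the number `n` that
the letter `0` adds. -/
def Computes {k : ℕ} (f : List.Vector ℕ k → ℕ) : Prop :=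
  ∀ (ins : Fin k → ℕ) (o m : ℕ), (∀ i, ins i < m ∧ ins i ≠ o) → o < m →
    ∃ P, IsProgram P ∧ ∀ (n : ℕ) (s : State), (∀ r, m ≤ r → s r = 0) →
      Det n P s (Function.update s o (s o + f (List.Vector.ofFn fun i => s (ins i))))

theorem computes_zero : Computes (k := 0) fun _ => 0 := fun _ _ _ _ _ =>
  ⟨1, isProgram_one, fun _ _ _ => det_one.congr (by simp)⟩

theorem computes_succ : Computes (k := 1) fun v => Nat.succ v.head := fun ins o m h ho =>
  ⟨copy (ins 0) o m * {[inc o]}, (isProgram_copy _ _ _).mul (isProgram_letter _), fun n s hs =>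
    ((det_copy (h 0).2 (h 0).1.ne ho.ne (hs m le_rfl)).mul (det_inc _)).congr (by
      simp [add_assoc])⟩

theorem computes_get {k : ℕ} (i : Fin k) : Computes fun v => v.get i := fun ins o m h ho =>
  ⟨copy (ins i) o m, isProgram_copy _ _ _, fun n s hs =>
    (det_copy (h i).2 (h i).1.ne ho.ne (hs m le_rfl)).congr (by simp)⟩

theorem Computes.comp {k l : ℕ} {f : List.Vector ℕ k → ℕ} {g : Fin k → List.Vector ℕ l → ℕ}
    (hf : Computes f) (hg : ∀ i, Computes (g i)) :
    Computes fun v => f (List.Vector.ofFn fun i => g i v) := by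
  intro ins o m h ho
  -- The value of `g i` is stored in counter `m + i`.
  let res : List.Vector ℕ l → ℕ → ℕ := fun v r => if hr : r < k then g ⟨r, hr⟩ v else 0
  have step : ∀ j ≤ k, ∃ P, IsProgram P ∧ ∀ (n : ℕ) (s : State), (∀ r, m ≤ r → s r = 0) →
      Det n P s fun r => if m ≤ r ∧ r < m + j then
        res (List.Vector.ofFn fun i => s (ins i)) (r - m) else s r := by
    intro j
    induction j with
    | zero =>
      refine fun _ => ⟨1, isProgram_one, fun n s _ => det_one.congr ?_⟩
      funext r
      rw [if_neg (by omega)]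
    | succ j ih =>
      intro hj
      obtain ⟨P, hP, hPs⟩ := ih (by omega)
      obtain ⟨Q, hQ, hQs⟩ := hg ⟨j, hj⟩ ins (m + j) (m + k)
        (fun i => ⟨by have := (h i).1; omega, by have := (h i).1; omega⟩) (by omega)
      refine ⟨P * Q, hP.mul hQ, fun n s hs => ((hPs n s hs).mul (hQs n _ ?_)).congr ?_⟩
      · intro r hr
        rw [if_neg (by omega)]
        exact hs r (by omega)
      · have hins : ∀ i, ¬ (m ≤ ins i ∧ ins i < m + j) := fun i => by have := (h i).1; omega
        funext r
        simp only [hins, if_false, Function.update_apply]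
        by_cases hr : r = m + j
        · subst hr
          have : j < k := hj
          simp [res, this, hs]
        · rw [if_neg hr]
          refine if_congr ?_ rfl rfl
          omega
  obtain ⟨P, hP, hPs⟩ := step k le_rfl
  obtain ⟨Q, hQ, hQs⟩ := hf (fun i => m + i) o (m + k)
    (fun i => ⟨by have := i.2; omega, by omega⟩) (by omega)
  obtain ⟨C, hC, hCs⟩ := exists_clear_range m k
  refine ⟨P * (Q * C), hP.mul (hQ.mul hC), fun n s hs =>
    ((hPs n s hs).mul ((hQs n _ ?_).mul (hCs n _))).congr ?_⟩
  · intro r hr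
    rw [if_neg (by omega)]
    exact hs r (by omega)
  · funext r
    have ho' : ¬ (m ≤ o ∧ o < m + k) := by omega
    by_cases hr : m ≤ r ∧ r < m + k
    · rw [if_pos hr, Function.update_of_ne (by omega), hs r hr.1]
    · simp only [hr, if_false, Function.update_apply, ho', res, le_add_iff_nonneg_right, zero_le,
        add_lt_add_iff_left, Fin.is_lt, and_self, if_true, add_tsub_cancel_left, dite_true, Fin.eta]

theorem Computes.prec {k : ℕ} {f : List.Vector ℕ k → ℕ} {g : List.Vector ℕ (k + 2) → ℕ}
    (hf : Computes f) (hg : Computes g) :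
    Computes fun v : List.Vector ℕ (k + 1) =>
      v.head.rec (f v.tail) fun y IH => g (y ::ᵥ IH ::ᵥ v.tail) := by
  intro ins o m h ho
  -- Counter `m` holds the argument of the recursion, `m + 1` the value there, `m + 2` the number
  -- of steps that remain, and `m + 3` the next value.
  obtain ⟨F, hF, hFs⟩ := hf (fun i => ins i.succ) (m + 1) (m + 2)
    (fun i => ⟨by have := (h i.succ).1; omega, by have := (h i.succ).1; omega⟩) (by omega)
  obtain ⟨G, hG, hGs⟩ := hg (Fin.cons m (Fin.cons (m + 1) fun i => ins i.succ)) (m + 3) (m + 4)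
    (fun i => by
      refine Fin.cases ?_ (fun i => ?_) i
      · simp
      · refine Fin.cases ?_ (fun i => ?_) i
        · simp
        · have := (h i.succ).1
          simp
          omega) (by omega)
  obtain ⟨C, hC, hCs⟩ := exists_clear_range m 2
  refine ⟨F * (copy (ins 0) (m + 2) (m + 3) *
    (loop (m + 2) (G * (clear (m + 1) * (copy (m + 3) (m + 1) (m + 4) *
      (clear (m + 3) * {[inc m]})))) * (copy (m + 1) o (m + 3) * C))),
    hF.mul ((isProgram_copy _ _ _).mul ((isProgram_loop _ (hG.mul ((isProgram_clear _).mul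
      ((isProgram_copy _ _ _).mul ((isProgram_clear _).mul (isProgram_letter _)))))).mul
        ((isProgram_copy _ _ _).mul hC))), fun n s hs => ?_⟩
  have h0 := (h 0).1
  set v := List.Vector.ofFn fun i => s (ins i.succ) with hv
  let R : ℕ → ℕ := fun y => Nat.rec (f v) (fun y IH => g (y ::ᵥ IH ::ᵥ v)) y
  let σ : ℕ → State := fun j => Function.update (Function.update (Function.update s m j)
    (m + 1) (R j)) (m + 2) (s (ins 0) - j)
  have hL := det_loop (n := n) (c := m + 2) (B := G * (clear (m + 1) *
    (copy (m + 3) (m + 1) (m + 4) * (clear (m + 3) * {[inc m]})))) (s (ins 0)) σ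
    (fun j hj => ⟨by simp [σ]; omega, by
      refine ((hGs n _ ?_).mul ((det_clear _).mul ((det_copy (by omega) (by omega) (by omega)
        ?_).mul ((det_clear _).mul (det_inc _))))).congr ?_
      · intro r hr
        simp only [σ, Function.update_apply]
        rw [if_neg (by omega), if_neg (by omega), if_neg (by omega), if_neg (by omega),
          hs r (by omega)]
      · simp [σ, hs]
      · have hins : ∀ i : Fin k, Function.update (σ j) (m + 2) (σ j (m + 2) - 1) (ins i.succ) =
            s (ins i.succ) := fun i => by
          have := (h i.succ).1
          simp only [σ, Function.update_apply]
          rw [if_neg (by omega), if_neg (by omega), if_neg (by omega), if_neg (by omega)]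
        have hvec : (List.Vector.ofFn fun i : Fin (k + 2) => Function.update (σ j) (m + 2)
            (σ j (m + 2) - 1) ((Fin.cons m (Fin.cons (m + 1) fun i => ins i.succ) :
              Fin (k + 2) → ℕ) i)) = j ::ᵥ R j ::ᵥ v := by
          rw [hv]
          simp only [List.Vector.ofFn, Fin.cons_zero, Fin.cons_succ, hins]
          simp [σ]
        rw [hvec]
        have hR : R (j + 1) = g (j ::ᵥ R j ::ᵥ v) := rfl
        funext r
        simp only [σ, Function.update_apply, hR]
        have := hs (m + 3) (by omega)
        split_ifs <;> subst_vars <;> omega⟩) (by simp [σ])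
  have h₁ : Det n (copy (ins 0) (m + 2) (m + 3))
      (Function.update s (m + 1) (s (m + 1) + f v)) (σ 0) := by
    refine (det_copy (by omega) (by omega) (by omega) ?_).congr ?_
    · simp [hs]
    · have hR : R 0 = f v := rfl
      funext r
      simp only [σ, Function.update_apply, hR]
      have := hs m le_rfl
      have := hs (m + 1) (by omega)
      have := hs (m + 2) (by omega)
      split_ifs <;> subst_vars <;> omega
  refine ((hFs n s fun r hr => hs r (by omega)).mul (h₁.mul (hL.mul ((det_copy (by omega)
    (by omega) (by omega) ?_).mul (hCs n _))))).congr ?_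
  · simp [σ, hs]
  · have hR : (List.Vector.ofFn fun i => s (ins i)).head.rec (motive := fun _ => ℕ)
        (f (List.Vector.ofFn fun i => s (ins i)).tail)
        (fun y IH => g (y ::ᵥ IH ::ᵥ (List.Vector.ofFn fun i => s (ins i)).tail)) =
        R (s (ins 0)) := by
      simp [R, hv]
    simp only [hR]
    funext r
    have := hs m le_rfl
    have := hs (m + 1) (by omega)
    have := hs (m + 2) (by omega)
    have := hs r
    simp only [σ, Function.update_apply]
    split_ifs <;> subst_vars <;> omega

theorem computes_of_primrec' {k : ℕ} {f : List.Vector ℕ k → ℕ} (hf : Nat.Primrec' f) :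
    Computes f := by
  induction hf with
  | zero => exact computes_zero
  | succ => exact computes_succ
  | get i => exact computes_get i
  | comp g _ _ hf hg => exact hf.comp hg
  | prec _ _ hf hg => exact hf.prec hg

/-- Existential quantification over a primitive recursive test is a question about a program: the
program loads the input into counter `0`, guesses a number in counter `1`, tests whether the value
of the function is zero, and clears the counters. -/
theorem exists_program_of_primrec {p : ℕ → ℕ → ℕ} (hp : Primrec₂ p) :
    ∃ P, IsProgram P ∧ ∀ n t, Sem n P (fun _ => 0) t ↔ (∃ k, p n k = 0) ∧ t = fun _ => 0 := by
  obtain ⟨F, hF, hFs⟩ := computes_of_primrec' (Nat.Primrec'.prim_iff₂.2 hp)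
    (fun i => (i : ℕ)) 2 3 (fun i => by have := i.2; omega) (by omega)
  refine ⟨{[0]} * (({[inc 1]} : Language ℕ)∗ * (F * ({[zero 2]} * (clear 0 * clear 1)))),
    (isProgram_letter _).mul ((isProgram_letter _).kstar.mul (hF.mul ((isProgram_letter _).mul
      ((isProgram_clear _).mul (isProgram_clear _))))), fun n t => ?_⟩
  simp only [sem_mul, sem_input, exists_eq_left, sem_kstar_inc]
  have key : ∀ k, Det n F (Function.update (Function.update (fun _ => 0) 0 (0 + n)) 1
      (Function.update (fun _ => 0) 0 (0 + n) 1 + k))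
      fun r => if r = 0 then n else if r = 1 then k else if r = 2 then p n k else 0 := by
    intro k
    refine (hFs n _ fun r hr => ?_).congr ?_
    · simp only [Function.update_apply]
      rw [if_neg (by omega), if_neg (by omega)]
    · funext r
      simp [List.Vector.ofFn, Function.update_apply]
      split_ifs <;> subst_vars <;> simp_all
  have hc : ∀ s t, Sem n (clear 0 * clear 1) s t ↔ _ :=
    fun s => (det_clear 0).mul (det_clear 1)
  simp only [sem_mul] at hc
  constructor
  · rintro ⟨_, ⟨k, rfl⟩, r, hr, q, hq, ht⟩
    rw [(key k r).1 hr, sem_zero] at hq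
    obtain ⟨h0, rfl⟩ := hq
    have h0 : p n k = 0 := h0
    refine ⟨⟨k, h0⟩, ((hc _ _).1 ht).trans ?_⟩
    funext r
    simp only [Function.update_apply, h0]
    split_ifs <;> rfl
  · rintro ⟨⟨k, hk⟩, rfl⟩
    refine ⟨_, ⟨k, rfl⟩, _, (key k _).2 rfl, _, sem_zero.2 ⟨hk, rfl⟩, (hc _ _).2 ?_⟩
    funext r
    simp only [Function.update_apply, hk]
    split_ifs <;> rfl

end CounterProgram

/-! ### Guarded automata for counter programs -/

namespace CounterProgram

/-- A word over the counter letters leads from the zero state to `s` if and only if `s` is given by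
the sums of the updates, these sums are non-negative for all prefixes, and the zero tests
succeed. -/
theorem exec_zero_iff {n : ℕ} {w : List ℕ} {s : State} :
    Exec n w (fun _ => 0) s ↔ (∀ i, (s i : ℤ) = (w.map (update n i)).sum) ∧
      (∀ i v, v <+: w → 0 ≤ (v.map (update n i)).sum) ∧
      ∀ i v, v ++ [zero i] <+: w → (v.map (update n i)).sum = 0 := by
  induction w using List.reverseRecOn generalizing s with
  | nil =>
    simp only [Exec, funext_iff]
    constructor
    · intro h
      refine ⟨by simp [h], ?_, ?_⟩
      · intro i v hv
        simp [List.prefix_nil.1 hv]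
      · intro i v hv
        simp at hv
    · intro h i
      simpa using h.1 i
  | append_singleton w a ih =>
    simp only [exec_append, ih, List.prefix_concat_iff, or_imp, forall_and, forall_eq]
    simp only [Exec, List.map_append, List.sum_append, List.map_cons,
      List.map_nil, List.sum_singleton]
    have hlast : ∀ i v, v ++ [zero i] = w ++ [a] ↔ v = w ∧ zero i = a := fun i v => by
      simp
    simp only [hlast, and_imp, forall_eq]
    constructor
    · rintro ⟨r, ⟨hr, hp, hz⟩, _, ⟨h, h0⟩, rfl⟩
      have e : ∀ i, (s i : ℤ) = (w.map (update n i)).sum + update n i a := fun i => by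
        rw [h i, hr i]
      refine ⟨e, ⟨fun i => by rw [← e]; omega, hp⟩, fun i hi => ?_, hz⟩
      rw [← hr i, h0 i hi.symm]
      rfl
    · rintro ⟨h, ⟨hl, hp⟩, h0, hz⟩
      have hr : ∀ i, ((w.map (update n i)).sum.toNat : ℤ) = (w.map (update n i)).sum := fun i =>
        Int.toNat_of_nonneg (hp i w (List.prefix_refl w))
      refine ⟨fun i => (w.map (update n i)).sum.toNat, ⟨hr, hp, hz⟩, s, ⟨fun i => ?_, ?_⟩, rfl⟩
      · rw [h i, hr i]
      · intro i hi
        dsimp only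
        rw [h0 i hi.symm]
        rfl

/-- The one-dimensional VASS with a single state, which is accepting, over the letters
`0, …, N - 1`, in which the letter `a` changes the counter by `u a`. -/
def oneState (N : ℕ) (u : ℕ → ℤ) : VASS 1 where
  numLetters := N
  numStates := 1
  trans := (List.range N).map fun a => (0, a, fun _ => u a, 0)
  init := 0
  accept := [0]

theorem mem_oneState_trans {N : ℕ} {u : ℕ → ℤ} {q a q' : ℕ} {x : Fin 1 → ℤ} :
    (q, a, x, q') ∈ (oneState N u).trans ↔ q = 0 ∧ a < N ∧ x = (fun _ => u a) ∧ q' = 0 := by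
  simp only [oneState, List.mem_map, List.mem_range, Prod.mk.injEq]
  constructor
  · rintro ⟨b, hb, rfl, rfl, rfl, rfl⟩
    exact ⟨rfl, hb, rfl, rfl⟩
  · rintro ⟨rfl, ha, rfl, rfl⟩
    exact ⟨a, ha, rfl, rfl, rfl, rfl⟩

theorem oneState_wellFormed (N : ℕ) (u : ℕ → ℤ) : (oneState N u).WellFormed := by
  refine ⟨Nat.one_pos, by simp [oneState], fun q a x q' h => ?_⟩
  obtain ⟨rfl, ha, -, rfl⟩ := mem_oneState_trans.1 h
  exact ⟨Nat.one_pos, ha, Nat.one_pos⟩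

theorem oneState_deterministic (N : ℕ) (u : ℕ → ℤ) : (oneState N u).Deterministic := by
  intro q a u₁ q₁ u₂ q₂ h₁ h₂
  obtain ⟨-, -, rfl, rfl⟩ := mem_oneState_trans.1 h₁
  obtain ⟨-, -, rfl, rfl⟩ := mem_oneState_trans.1 h₂
  exact ⟨rfl, rfl⟩

theorem oneState_run_iff {N : ℕ} {u : ℕ → ℤ} {w : List ℕ} {c : VASS.Config 1} :
    (oneState N u).Run w c ↔ c.1 = 0 ∧ (∀ a ∈ w, a < N) ∧ (c.2 0 : ℤ) = (w.map u).sum ∧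
      ∀ v, v <+: w → 0 ≤ (v.map u).sum := by
  constructor
  · intro h
    induction h with
    | nil =>
      refine ⟨rfl, by simp, by simp, fun v hv => ?_⟩
      simp [List.prefix_nil.1 hv]
    | @snoc w c c' a _ hs ih =>
      obtain ⟨-, hw, hc, hp⟩ := ih
      obtain ⟨x, hx, hx'⟩ := hs
      obtain ⟨-, ha, rfl, hq⟩ := mem_oneState_trans.1 hx
      have e : (c'.2 0 : ℤ) = ((w ++ [a]).map u).sum := by
        rw [hx' 0, hc]
        simp
      refine ⟨hq, ?_, e, fun v hv => ?_⟩
      · intro b hb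
        rcases List.mem_append.1 hb with hb | hb
        · exact hw b hb
        · rwa [List.mem_singleton.1 hb]
      · rcases List.prefix_concat_iff.1 hv with rfl | hv
        · rw [← e]
          omega
        · exact hp v hv
  · induction w using List.reverseRecOn generalizing c with
    | nil =>
      rintro ⟨h, -, hc, -⟩
      have : c = ((oneState N u).init, fun _ => 0) := by
        refine Prod.ext h (funext fun i => ?_)
        rw [Subsingleton.elim i 0]
        simpa using hc
      rw [this]
      exact .nil
    | append_singleton w a ih =>
      rintro ⟨h, hw, hc, hp⟩
      have h0 := hp w (List.prefix_append w [a])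
      refine VASS.Run.snoc (c := (0, fun _ => (w.map u).sum.toNat))
        (ih ⟨rfl, fun b hb => hw b (by simp [hb]), Int.toNat_of_nonneg h0,
          fun v hv => hp v (hv.trans (List.prefix_append w [a]))⟩)
        ⟨fun _ => u a, mem_oneState_trans.2 ⟨rfl, hw a (by simp), rfl, h⟩, fun i => ?_⟩
      rw [Subsingleton.elim i 0, hc, Int.toNat_of_nonneg h0]
      simp

theorem mem_oneState_reachLanguage {N : ℕ} {u : ℕ → ℤ} {w : List ℕ} :
    w ∈ (oneState N u).reachLanguage ↔ (∀ a ∈ w, a < N) ∧ (w.map u).sum = 0 ∧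
      ∀ v, v <+: w → 0 ≤ (v.map u).sum := by
  constructor
  · rintro ⟨q, -, h⟩
    obtain ⟨-, hw, h, hp⟩ := oneState_run_iff.1 h
    exact ⟨hw, h.symm, hp⟩
  · rintro ⟨hw, h, hp⟩
    exact ⟨0, by simp [oneState], oneState_run_iff.2 ⟨rfl, hw, h.symm, hp⟩⟩

/-- The guard of the letter `a`: a zero test `zero i` is guarded by the VASS that follows counter
`i`, and all other letters are unguarded. -/
def guard (N n a : ℕ) : VASS 1 :=
  oneState N (if a ≠ 0 ∧ a % 3 = 0 then update n (a / 3 - 1) else fun _ => 0)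

theorem guard_zero (N n i : ℕ) : guard N n (zero i) = oneState N (update n i) := by
  have h : zero i ≠ 0 ∧ zero i % 3 = 0 := by simp only [zero]; omega
  have h' : zero i / 3 - 1 = i := by simp only [zero]; omega
  rw [guard, if_pos h, h']

theorem mem_guard {N n a : ℕ} {w : List ℕ} (hw : ∀ b ∈ w, b < N) :
    w ∈ (guard N n a).reachLanguage ↔ ∀ i, a = zero i → (w.map (update n i)).sum = 0 ∧
      ∀ v, v <+: w → 0 ≤ (v.map (update n i)).sum := by
  by_cases h : a ≠ 0 ∧ a % 3 = 0
  · obtain ⟨i, rfl⟩ : ∃ i, a = zero i := ⟨a / 3 - 1, by simp only [zero]; omega⟩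
    have hz : ∀ j, zero i = zero j ↔ i = j := fun j => by simp only [zero]; omega
    rw [guard_zero, mem_oneState_reachLanguage]
    simp only [hz, forall_eq']
    exact and_iff_right hw
  · rw [guard, if_neg h, mem_oneState_reachLanguage]
    refine iff_of_true ⟨hw, by simp, by simp⟩ ?_
    rintro i rfl
    exact absurd (by simp only [zero]; omega) h

variable {S : ℕ}

/-- The transitions of a DFA on the letters `0, …, N - 1`. -/
def transitions (M : DFA ℕ (Fin S)) (N : ℕ) : List (ℕ × ℕ × ℕ) :=
  (List.finRange S).flatMap fun q : Fin S => (List.range N).map fun a => ((q : ℕ), a, (M.step q a : ℕ))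

theorem mem_transitions {M : DFA ℕ (Fin S)} {N q a q' : ℕ} :
    (q, a, q') ∈ transitions M N ↔ ∃ h : q < S, a < N ∧ q' = M.step ⟨q, h⟩ a := by
  simp only [transitions, List.mem_flatMap, List.mem_finRange, true_and, List.mem_map,
    List.mem_range, Prod.mk.injEq]
  constructor
  · rintro ⟨p, b, hb, rfl, rfl, rfl⟩
    exact ⟨p.2, hb, rfl⟩
  · rintro ⟨h, ha, rfl⟩
    exact ⟨⟨q, h⟩, a, ha, rfl, rfl, rfl⟩

open scoped Classical in
/-- The DFA `M`, restricted to the letters `0, …, N - 1`, with the guards for the input `n`. -/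
noncomputable def system (M : DFA ℕ (Fin S)) (N n : ℕ) : GuardedFA where
  numLetters := N
  numStates := S
  trans := (transitions M N).map fun t => (t, guard N n t.2.1)
  init := M.start
  accept := ((List.finRange S).filter (· ∈ M.accept)).map Fin.val

theorem mem_system_trans {M : DFA ℕ (Fin S)} {N n q a q' : ℕ} {G : VASS 1} :
    ((q, a, q'), G) ∈ (system M N n).trans ↔
      (∃ h : q < S, a < N ∧ q' = M.step ⟨q, h⟩ a) ∧ G = guard N n a := by
  simp only [system, List.mem_map, Prod.mk.injEq, ← mem_transitions]
  constructor
  · rintro ⟨_, ht, rfl, rfl⟩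
    exact ⟨ht, rfl⟩
  · rintro ⟨ht, rfl⟩
    exact ⟨_, ht, rfl, rfl⟩

theorem system_isDFAReachOneDVASS (M : DFA ℕ (Fin S)) (N n : ℕ) :
    (system M N n).IsDFAReachOneDVASS := by
  refine ⟨M.start.2, fun q hq => ?_, fun q a q' G h => ?_, fun q a q₁ G₁ q₂ G₂ h₁ h₂ => ?_⟩
  · obtain ⟨p, -, rfl⟩ := List.mem_map.1 hq
    exact p.2
  · obtain ⟨⟨hq, ha, rfl⟩, rfl⟩ := mem_system_trans.1 h
    exact ⟨hq, ha, Fin.is_lt _, rfl, oneState_wellFormed _ _, oneState_deterministic _ _⟩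
  · obtain ⟨⟨_, _, rfl⟩, rfl⟩ := mem_system_trans.1 h₁
    obtain ⟨⟨_, _, rfl⟩, rfl⟩ := mem_system_trans.1 h₂
    exact ⟨rfl, rfl⟩

theorem system_run_iff {M : DFA ℕ (Fin S)} {N n : ℕ} {w : List ℕ} {q : ℕ} :
    (system M N n).toHCS.Run w q ↔ q = M.eval w ∧ (∀ a ∈ w, a < N) ∧
      ∀ i v, v ++ [zero i] <+: w → (v.map (update n i)).sum = 0 ∧
        ∀ v', v' <+: v → 0 ≤ (v'.map (update n i)).sum := by
  constructor
  · intro h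
    induction h with
    | nil => exact ⟨rfl, by simp, fun i v hv => by simp at hv⟩
    | @snoc w q q' a _ ht hg ih =>
      obtain ⟨rfl, hw, hz⟩ := ih
      obtain ⟨G, ht⟩ := ht
      obtain ⟨⟨_, ha, rfl⟩, -⟩ := mem_system_trans.1 ht
      obtain ⟨G', ht', hg⟩ := hg
      obtain ⟨-, rfl⟩ := mem_system_trans.1 ht'
      rw [mem_guard hw] at hg
      refine ⟨by simp, ?_, fun i v hv => ?_⟩
      · intro b hb
        rcases List.mem_append.1 hb with hb | hb
        · exact hw b hb
        · rwa [List.mem_singleton.1 hb]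
      · rcases List.prefix_concat_iff.1 hv with hv | hv
        · obtain ⟨rfl, e⟩ := List.append_inj' hv rfl
          exact hg i (by simpa using e.symm)
        · exact hz i v hv
  · induction w using List.reverseRecOn generalizing q with
    | nil =>
      rintro ⟨rfl, -, -⟩
      exact .nil
    | append_singleton w a ih =>
      rintro ⟨rfl, hw, hz⟩
      have hw' : ∀ b ∈ w, b < N := fun b hb => hw b (by simp [hb])
      have ht : (((M.eval w : ℕ), a, (M.eval (w ++ [a]) : ℕ)), guard N n a) ∈
          (system M N n).trans :=
        mem_system_trans.2 ⟨⟨Fin.is_lt _, hw a (by simp), by simp⟩, rfl⟩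
      refine HCS.Run.snoc (ih ⟨rfl, hw', fun i v hv =>
        hz i v (hv.trans (List.prefix_append w [a]))⟩) ⟨_, ht⟩ ⟨_, ht, (mem_guard hw').2 ?_⟩
      rintro i rfl
      exact hz i w (List.prefix_refl _)

theorem mem_system_language {M : DFA ℕ (Fin S)} {N n : ℕ} {w : List ℕ} :
    w ∈ (system M N n).language ↔ w ∈ M.accepts ∧ (∀ a ∈ w, a < N) ∧
      ∀ i v, v ++ [zero i] <+: w → (v.map (update n i)).sum = 0 ∧
        ∀ v', v' <+: v → 0 ≤ (v'.map (update n i)).sum := by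
  have hacc : ∀ q : Fin S, (q : ℕ) ∈ (system M N n).toHCS.accept ↔ q ∈ M.accept := fun q => by
    classical
    simp only [GuardedFA.toHCS, system, Set.mem_ofPred_eq, List.mem_map, List.mem_filter,
      List.mem_finRange, true_and, decide_eq_true_eq, Fin.val_inj, exists_eq_right]
  rw [DFA.mem_accepts]
  constructor
  · rintro ⟨q, hq, h⟩
    obtain ⟨rfl, h'⟩ := system_run_iff.1 h
    exact ⟨(hacc _).1 hq, h'⟩
  · rintro ⟨hq, h⟩
    exact ⟨_, (hacc _).2 hq, system_run_iff.2 ⟨rfl, h⟩⟩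

theorem isProgram_word (w : List ℕ) : IsProgram {w} := by
  induction w with
  | nil => exact isProgram_one
  | cons a w ih =>
    convert (isProgram_letter a).mul ih using 1
    ext v
    rw [Language.mem_mul]
    constructor
    · rintro rfl
      exact ⟨[a], rfl, w, rfl, rfl⟩
    · rintro ⟨_, rfl, _, rfl, rfl⟩
      rfl

/-- Every program can be turned into guarded automata, uniformly in the input: the program is
followed by a zero test of each of its counters. The guards of these final tests check that no
counter ever was negative and that all counters are zero at the end. -/
theorem exists_system_of_isProgram {P : Language ℕ} (hP : IsProgram P) :
    ∃ (S : ℕ) (M : DFA ℕ (Fin S)) (N : ℕ), ∀ n,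
      (system M N n).language = ∅ ↔ ¬ Sem n P (fun _ => 0) (fun _ => 0) := by
  obtain ⟨-, K, hK⟩ := id hP
  -- The counters from `K + 1` on are changed by no letter of `P`; counter `0` is included
  -- because of the letter `0`.
  set z : ℕ → List ℕ := fun R => (List.range R).map zero with hz
  have hz_sum : ∀ n i R, ((z R).map (update n i)).sum = 0 := fun n i R => by
    refine List.sum_eq_zero fun x hx => ?_
    simp only [hz, List.map_map, List.mem_map, Function.comp_apply, update_zero] at hx
    obtain ⟨_, -, rfl⟩ := hx
    rfl
  have hz_exec : ∀ n R, Exec n (z R) (fun _ => 0) (fun _ => 0) := by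
    intro n R
    induction R with
    | zero => rfl
    | succ R ih =>
      rw [hz]
      simp only [List.range_succ, List.map_append, exec_append]
      exact ⟨_, ih, _, sem_letter.1 (sem_zero.2 ⟨rfl, rfl⟩), rfl⟩
  obtain ⟨⟨σ, _, M, hM⟩, N, hN⟩ := hP.mul (isProgram_word (z (K + 1)))
  refine ⟨_, DFA.reindex (Fintype.equivFin σ) M, N, fun n => ?_⟩
  rw [← Set.not_nonempty_iff_eq_empty, not_iff_not]
  constructor
  · rintro ⟨w, hw⟩
    obtain ⟨hw, -, hg⟩ := mem_system_language.1 hw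
    rw [DFA.accepts_reindex, hM] at hw
    obtain ⟨u, hu, _, rfl, rfl⟩ := hw
    have key : ∀ i, (u.map (update n i)).sum = 0 ∧
        ∀ v, v <+: u → 0 ≤ (v.map (update n i)).sum := by
      intro i
      by_cases hi : i < K + 1
      · obtain ⟨h, h'⟩ := hg i (u ++ z i) (by
          obtain ⟨j, hj⟩ := Nat.exists_eq_add_of_le (Nat.succ_le_of_lt hi)
          rw [List.append_assoc, List.prefix_append_right_inj, hj]
          simp [hz, List.range_add, List.range_succ])
        rw [List.map_append, List.sum_append, hz_sum, add_zero] at h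
        exact ⟨h, fun v hv => h' v (hv.trans (List.prefix_append _ _))⟩
      · have h0 : ∀ v, v <+: u → (v.map (update n i)).sum = 0 := fun v hv => by
          refine List.sum_eq_zero fun x hx => ?_
          obtain ⟨a, ha, rfl⟩ := List.mem_map.1 hx
          have := hK u hu a (hv.subset ha)
          rw [update, if_neg (show ¬ a = inc i by simp only [inc]; omega),
            if_neg (show ¬ a = dec i by simp only [dec]; omega),
            if_neg (show ¬ i = 0 by omega), ite_self]
        exact ⟨h0 u (List.prefix_refl u), fun v hv => (h0 v hv).ge⟩
    exact ⟨u, hu, exec_zero_iff.2 ⟨fun i => by rw [(key i).1]; rfl, fun i => (key i).2,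
      fun i v hv => (hg i v (hv.trans (List.prefix_append _ _))).1⟩⟩
  · rintro ⟨u, hu, h⟩
    have hw := Language.append_mem_mul hu (show z (K + 1) ∈ ({z (K + 1)} : Language ℕ) from rfl)
    obtain ⟨-, hp, ht⟩ := exec_zero_iff.1 (exec_append.2 ⟨_, h, hz_exec n (K + 1)⟩)
    refine ⟨u ++ z (K + 1), mem_system_language.2 ⟨?_, hN _ hw, fun i v hv =>
      ⟨ht i v hv, fun v' hv' => hp i v' (hv'.trans ((List.prefix_append _ _).trans hv))⟩⟩⟩
    rwa [DFA.accepts_reindex, hM]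

end CounterProgram

/-! ### Computability of the reduction -/

namespace CounterProgram

theorem primrec_list_map_of_forall {α β γ : Type*} [Primcodable α] [Primcodable γ]
    (L : List β) {F : β → α → γ} (hF : ∀ x, Primrec (F x)) :
    Primrec fun n => L.map fun x => F x n := by
  induction L with
  | nil => exact .const []
  | cons x L ih => exact Primrec.list_cons.comp (hF x) ih

theorem primrec_natCast_int : Primrec fun n : ℕ => (n : ℤ) :=
  Primrec.encode_iff.1 (Primrec.nat_double.of_eq fun _ => rfl)

theorem primrec_update (i a : ℕ) : Primrec fun n => update n i a := by
  unfold update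
  split_ifs
  · exact primrec_natCast_int
  all_goals exact .const _

theorem primrec_oneState (N : ℕ) {u : ℕ → ℕ → ℤ} (hu : ∀ a, Primrec fun n => u n a) :
    Primrec fun n => oneState N (u n) := by
  have hvec : ∀ a, Primrec fun n => (fun _ => u n a : Fin 1 → ℤ) := fun a =>
    Primrec.fin_curry.2 (show Primrec₂ fun n (_ : Fin 1) => u n a from (hu a).comp Primrec.fst)
  have htrans : Primrec fun n => (oneState N (u n)).trans :=
    primrec_list_map_of_forall _ fun a => (Primrec.const 0).pair <| (Primrec.const a).pair <|
      (hvec a).pair (.const 0)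
  exact (Primrec.of_equiv_symm (e := VASS.equivTuple 1)).comp <| (Primrec.const N).pair <|
    (Primrec.const 1).pair <| htrans.pair <| (Primrec.const 0).pair (.const [0])

theorem primrec_guard (N a : ℕ) : Primrec fun n => guard N n a := by
  unfold guard
  refine primrec_oneState N fun b => ?_
  split_ifs
  · exact primrec_update _ b
  · exact .const 0

theorem primrec_system {S : ℕ} (M : DFA ℕ (Fin S)) (N : ℕ) : Primrec (system M N) := by
  have htrans : Primrec fun n => (system M N n).trans :=
    primrec_list_map_of_forall _ fun t => (Primrec.const t).pair (primrec_guard N t.2.1)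
  exact (Primrec.of_equiv_symm (e := GuardedFA.equivTuple)).comp <| (Primrec.const N).pair <|
    (Primrec.const S).pair <| htrans.pair <| (Primrec.const _).pair (.const _)

end CounterProgram

open Nat.Partrec in
/-- The halting problem as an existentially quantified primitive recursive test. -/
theorem exists_primrec_halting : ∃ p : ℕ → ℕ → ℕ, Primrec₂ p ∧
    ∀ c : Code, (c.eval 0).Dom ↔ ∃ k, p (Encodable.encode c) k = 0 := by
  refine ⟨fun n k => bif (Code.evaln k (Denumerable.ofNat Code n) 0).isSome then 0 else 1,
    ?_, fun c => ?_⟩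
  · exact Primrec.cond (Primrec.option_isSome.comp (Code.primrec_evaln.comp
      ((Primrec.snd.pair ((Primrec.ofNat Code).comp Primrec.fst)).pair (.const 0))))
      (.const 0) (.const 1)
  · simp only [Part.dom_iff_mem, Code.evaln_complete, Denumerable.ofNat_encode]
    rw [exists_comm]
    refine exists_congr fun k => ?_
    cases h : Code.evaln k c 0 <;> simp

/-- Language emptiness for DFA[Reach-1-DVASS] is undecidable: there is no computable function that,
given the finite description of any such system `A`, decides whether the language of `A` is empty.
(Nothing is asked of the function on inputs that do not describe such a system.) -/
theorem mainTheorem3 :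
    ¬ ∃ f : GuardedFA → Bool, Computable f ∧
      ∀ A : GuardedFA, A.IsDFAReachOneDVASS →
        (f A = true ↔ A.language = ∅) := by
  rintro ⟨f, hf, h⟩
  obtain ⟨p, hp, hpc⟩ := exists_primrec_halting
  obtain ⟨P, hP, hPs⟩ := CounterProgram.exists_program_of_primrec hp
  obtain ⟨S, M, N, hM⟩ := CounterProgram.exists_system_of_isProgram hP
  refine ComputablePred.halting_problem 0 (ComputablePred.computable_iff.2
    ⟨fun c => !f (CounterProgram.system M N (Encodable.encode c)), ?_, ?_⟩)
  · exact Primrec.not.to_comp.comp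
      (hf.comp ((CounterProgram.primrec_system M N).comp Primrec.encode).to_comp)
  · funext c
    rw [hpc, Bool.not_eq_true', ← Bool.not_eq_true,
      h _ (CounterProgram.system_isDFAReachOneDVASS M N _), hM, hPs, not_not]
    simp
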